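/- For an integer $n>0$ let $$J_n=\{x\,x_1\cdots x_k \mid k>0,\ x,x_1,\dots,x_k\in\{a,b\}^n,\ x_j=x\text{ for some }j\in\{1,\dots,k\}\},$$ $$K_n=\{x_1\cdots x_k\,x \mid k>0,\ x_1,\dots,x_k,x\in\{a,b\}^n,\ x_j=x\text{ for some }j\in\{1,\dots,k\}\}.$$ One-way automata (1DFAs and 1NFAs) are the usual finite automata; the transition function of a 1DFA may be partial. A two-way nondeterministic finite automaton (2NFA) has its input $w$ on a read-only tape between two end-markers, the left one in cell $0$ and the right one in cell $|w|+1$. It starts in its initial state on cell $1$, and each move, chosen nondeterministically according to the state and the scanned symbol, changes the state and moves the head one cell to the left or to the right. The head may not pass the left end-marker. It may pass the right one, which ends the computation, and $w$ is accepted if some computation ends in this way in a final state. Then for every integer $n>0$: 1. Every 1DFA and every 1NFA accepting $J_n$ has at least $2^n$ states, and every 2NFA accepting $J_n$ has at least $2^{\frac{n-1}{2}}$ states. 2. Every 1DFA accepting $K_n$ has at least $2^{2^n}$ states, every 1NFA accepting $K_n$ has at least $2^n$ states, and every 2NFA accepting $K_n$ has at least $2^{\frac{n-1}{2}}$ states.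 -/

import Mathlib

/-- A one-way nondeterministic automaton is deterministic if it has exactly one initial state and
at most one move for every state and every letter (the transition function may be partial). -/
def NFA.IsDeterministic {α σ : Type*} (M : NFA α σ) : Prop :=
  (∃ q, M.start = {q}) ∧ ∀ q c, (M.step q c).Subsingleton

/-- Every (complete) `DFA` is deterministic in the above sense. -/
theorem DFA.isDeterministic_toNFA {α σ : Type*} (M : DFA α σ) : M.toNFA.IsDeterministic :=
  ⟨⟨M.start, rfl⟩, fun _ _ => Set.subsingleton_singleton⟩

/-- Symbols on the tape of a two-way automaton: input letters and the two end-markers. -/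
inductive TapeSymbol (α : Type*) where
  | leftEnd : TapeSymbol α
  | letter (c : α) : TapeSymbol α
  | rightEnd : TapeSymbol α

/-- A two-way nondeterministic finite automaton with input alphabet `α` and set of states `σ`.
In each move the head goes one cell to the left or one cell to the right. -/
structure TwoNFA (α σ : Type*) where
  /-- the transition function -/
  step : σ → TapeSymbol α → Set (σ × Turing.Dir)
  /-- the initial state -/
  start : σ
  /-- the final states -/
  accept : Set σ

namespace TwoNFA

/-- The tape on input `w`: the left end-marker is in cell `0`, the letters of `w` are in the cells
`1, …, |w|`, and the right end-marker is in cell `|w| + 1`. -/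
def tape {α : Type*} (w : List α) : List (TapeSymbol α) :=
  TapeSymbol.leftEnd :: (w.map TapeSymbol.letter ++ [TapeSymbol.rightEnd])

/-- One move between configurations (state, head position) on input `w`. The head cannot move left
from cell `0`. It can move right from cell `|w| + 1`, that is, pass the right end-marker;
there is no further move from the position `|w| + 2` that it then has. -/
inductive Move {α σ : Type*} (M : TwoNFA α σ) (w : List α) : σ × ℕ → σ × ℕ → Prop
  | right {p q : σ} {i : ℕ} {s : TapeSymbol α} :
      (tape w)[i]? = some s → (q, Turing.Dir.right) ∈ M.step p s → Move M w (p, i) (q, i + 1)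
  | left {p q : σ} {i : ℕ} {s : TapeSymbol α} :
      (tape w)[i + 1]? = some s → (q, Turing.Dir.left) ∈ M.step p s → Move M w (p, i + 1) (q, i)

/-- The accepted language: the words `w` for which some computation starts in the initial state
with the head on cell `1` and ends in a final state after passing the right end-marker. -/
def accepts {α σ : Type*} (M : TwoNFA α σ) : Language α :=
  {w | ∃ q ∈ M.accept, Relation.ReflTransGen (M.Move w) (M.start, 1) (q, w.length + 2)}

end TwoNFA

/-- The language `J_n` of the words `x x_1 ⋯ x_k`, with `k > 0` and `x, x_1, …, x_k` of length `n`,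
such that `x = x_j` for some `j`. The alphabet `{a, b}` is `Bool`. -/
def langJ (n : ℕ) : Language Bool :=
  {w | ∃ (x : List Bool) (xs : List (List Bool)), 0 < xs.length ∧ x.length = n ∧
    (∀ y ∈ xs, y.length = n) ∧ x ∈ xs ∧ w = x ++ xs.flatten}

/-- The language `K_n` of the words `x_1 ⋯ x_k x`, with `k > 0` and `x_1, …, x_k, x` of length `n`,
such that `x_j = x` for some `j`. The alphabet `{a, b}` is `Bool`. -/
def langK (n : ℕ) : Language Bool :=
  {w | ∃ (xs : List (List Bool)) (x : List Bool), 0 < xs.length ∧ (∀ y ∈ xs, y.length = n) ∧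
    x.length = n ∧ x ∈ xs ∧ w = xs.flatten ++ x}

/-! ### Block words -/

/-! Since `n > 0`, a word has at most one cutting into blocks of length `n`. For a set `S` of blocks
let `w_S` list its elements; then `w_S x ∈ K_n` and `x w_S ∈ J_n` each mean `x ∈ S`. So the `2 ^ 2 ^
n` words `w_S` are pairwise inequivalent as prefixes for `K_n` and as suffixes for `J_n`.

A 1DFA must reach different states on inequivalent prefixes. For 1NFAs the pairs `(x, x)` form a
fooling set of size `2 ^ n`, as `x y` lies in either language only if `x = y`.

For a 2NFA with `N` states, cut the input in two. What one side contributes to acceptance is a set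
of states and a binary relation on states, recording how the head crosses the cut
(`TwoNFA.append_mem_accepts_iff`). There are at most `2 ^ (N + N ^ 2)` such behaviours, hence `2 ^ n
≤ N + N ^ 2 ≤ 2 * N ^ 2`. -/

theorem List.length_flatten_of_forall_length_eq {α : Type*} {n : ℕ} {xs : List (List α)}
    (h : ∀ y ∈ xs, y.length = n) : xs.flatten.length = xs.length * n := by
  induction xs with
  | nil => simp
  | cons a l ih =>
    simp only [List.mem_cons, forall_eq_or_imp] at h
    simp [ih h.2, h.1, Nat.succ_mul, Nat.add_comm]

/-- The total length determines the number of blocks because `n > 0`; for `n = 0` every list of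
empty words has the same flattening. -/
theorem List.flatten_inj_of_forall_length_eq {α : Type*} {n : ℕ} (hn : 0 < n)
    {xs ys : List (List α)} (hx : ∀ y ∈ xs, y.length = n) (hy : ∀ y ∈ ys, y.length = n)
    (h : xs.flatten = ys.flatten) : xs = ys := by
  refine List.eq_iff_flatten_eq.2 ⟨h, ?_⟩
  have hl : xs.length = ys.length := by
    have := congrArg List.length h
    rw [length_flatten_of_forall_length_eq hx, length_flatten_of_forall_length_eq hy] at this
    exact Nat.eq_of_mul_eq_mul_right hn this
  rw [List.map_congr_left hx, List.map_congr_left hy]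
  simp [hl]

theorem append_flatten_mem_langJ_iff {n : ℕ} (hn : 0 < n) {xs : List (List Bool)} {x : List Bool}
    (hxs : ∀ y ∈ xs, y.length = n) (hx : x.length = n) :
    x ++ xs.flatten ∈ langJ n ↔ x ∈ xs := by
  refine ⟨?_, fun h => ⟨x, xs, List.length_pos_of_mem h, hx, hxs, h, rfl⟩⟩
  rintro ⟨y, ys, -, hy, hys, hmem, heq⟩
  obtain ⟨rfl, h⟩ := List.append_inj heq (hx.trans hy.symm)
  rwa [List.flatten_inj_of_forall_length_eq hn hxs hys h]

theorem flatten_append_mem_langK_iff {n : ℕ} (hn : 0 < n) {xs : List (List Bool)} {x : List Bool}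
    (hxs : ∀ y ∈ xs, y.length = n) (hx : x.length = n) :
    xs.flatten ++ x ∈ langK n ↔ x ∈ xs := by
  refine ⟨?_, fun h => ⟨xs, x, List.length_pos_of_mem h, hxs, hx, h, rfl⟩⟩
  rintro ⟨ys, y, -, hys, hy, hmem, heq⟩
  obtain ⟨h, rfl⟩ := List.append_inj' heq (hx.trans hy.symm)
  rwa [List.flatten_inj_of_forall_length_eq hn hxs hys h]

/-- The blocks of length `n` that belong to `S`, in some order. -/
noncomputable def blockList {n : ℕ} (S : Finset (Fin n → Bool)) : List (List Bool) :=
  S.toList.map List.ofFn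

theorem length_of_mem_blockList {n : ℕ} {S : Finset (Fin n → Bool)} {y : List Bool}
    (hy : y ∈ blockList S) : y.length = n := by
  obtain ⟨x, -, rfl⟩ := List.mem_map.1 hy
  simp

theorem ofFn_mem_blockList_iff {n : ℕ} {S : Finset (Fin n → Bool)} {x : Fin n → Bool} :
    List.ofFn x ∈ blockList S ↔ x ∈ S := by
  simp [blockList, List.ofFn_injective.eq_iff]

theorem ofFn_append_blockList_mem_langJ_iff {n : ℕ} (hn : 0 < n) {S : Finset (Fin n → Bool)}
    {x : Fin n → Bool} : List.ofFn x ++ (blockList S).flatten ∈ langJ n ↔ x ∈ S :=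
  (append_flatten_mem_langJ_iff hn (fun _ => length_of_mem_blockList) List.length_ofFn).trans
    ofFn_mem_blockList_iff

theorem blockList_append_ofFn_mem_langK_iff {n : ℕ} (hn : 0 < n) {S : Finset (Fin n → Bool)}
    {x : Fin n → Bool} : (blockList S).flatten ++ List.ofFn x ∈ langK n ↔ x ∈ S :=
  (flatten_append_mem_langK_iff hn (fun _ => length_of_mem_blockList) List.length_ofFn).trans
    ofFn_mem_blockList_iff

theorem ofFn_append_ofFn_mem_langJ_iff {n : ℕ} (hn : 0 < n) {x y : Fin n → Bool} :
    List.ofFn x ++ List.ofFn y ∈ langJ n ↔ x = y := by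
  simpa [List.ofFn_injective.eq_iff] using
    append_flatten_mem_langJ_iff hn (xs := [List.ofFn y]) (x := List.ofFn x) (by simp) (by simp)

theorem ofFn_append_ofFn_mem_langK_iff {n : ℕ} (hn : 0 < n) {x y : Fin n → Bool} :
    List.ofFn x ++ List.ofFn y ∈ langK n ↔ x = y := by
  simpa [List.ofFn_injective.eq_iff, eq_comm] using
    flatten_append_mem_langK_iff hn (xs := [List.ofFn x]) (x := List.ofFn y) (by simp) (by simp)

/-! ### One-way automata -/

namespace NFA

variable {α σ : Type*}

theorem append_mem_accepts_iff (M : NFA α σ) {u v : List α} :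
    u ++ v ∈ M.accepts ↔ ∃ q ∈ M.eval u, ∃ f ∈ M.accept, f ∈ M.evalFrom {q} v := by
  rw [accepts_eq_acceptsFrom_start, append_mem_acceptsFrom, mem_acceptsFrom]
  change (∃ f ∈ M.accept, f ∈ M.evalFrom (M.eval u) v) ↔ _
  simp_rw [M.mem_evalFrom_iff_exists (S := M.eval u)]
  exact ⟨fun ⟨f, hf, q, hq, h⟩ => ⟨q, hq, f, hf, h⟩, fun ⟨q, hq, f, hf, h⟩ => ⟨f, hf, q, hq, h⟩⟩

/-- The fooling set method. -/
theorem card_le_of_fooling_set {ι : Type*} [Fintype ι] [Fintype σ] (M : NFA α σ) (u v : ι → List α)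
    (h : ∀ i j, u i ++ v j ∈ M.accepts ↔ i = j) : Fintype.card ι ≤ Fintype.card σ := by
  have h' (i : ι) := M.append_mem_accepts_iff.1 ((h i i).2 rfl)
  choose q hq hf using h'
  -- `q i` lies between `u i` and `v i` on an accepting path. If `q i = q j`, the first half of path
  -- `i` and the second half of path `j` combine to accept `u i ++ v j`.
  refine Fintype.card_le_of_injective q fun i j hij => ?_
  refine (h i j).1 (M.append_mem_accepts_iff.2 ⟨q i, hq i, ?_⟩)
  rw [hij]
  exact hf j

theorem IsDeterministic.subsingleton_eval {M : NFA α σ} (hM : M.IsDeterministic) (w : List α) :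
    (M.eval w).Subsingleton := by
  induction w using List.reverseRecOn with
  | nil =>
    obtain ⟨q, hq⟩ := hM.1
    rw [eval_nil, hq]
    exact Set.subsingleton_singleton
  | append_singleton w a ih =>
    rw [eval_append_singleton]
    intro p hp q hq
    obtain ⟨p', hp', hp⟩ := M.mem_stepSet.1 hp
    obtain ⟨q', hq', hq⟩ := M.mem_stepSet.1 hq
    obtain rfl := ih hp' hq'
    exact hM.2 _ _ hp hq

/-- Pairwise inequivalent prefixes of accepted words lead to different states. -/
theorem IsDeterministic.card_le {ι : Type*} [Fintype ι] [Fintype σ] {M : NFA α σ}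
    (hM : M.IsDeterministic) (u : ι → List α) (hu : ∀ i, ∃ v, u i ++ v ∈ M.accepts)
    (h : ∀ i j, (∀ v, u i ++ v ∈ M.accepts ↔ u j ++ v ∈ M.accepts) → i = j) :
    Fintype.card ι ≤ Fintype.card σ := by
  have h' (i : ι) : ∃ q, M.eval (u i) = {q} := by
    obtain ⟨v, hv⟩ := hu i
    obtain ⟨q, hq, -⟩ := M.append_mem_accepts_iff.1 hv
    exact ⟨q, (hM.subsingleton_eval _).eq_singleton_of_mem hq⟩
  choose q hq using h'
  refine Fintype.card_le_of_injective q fun i j hij => h i j fun v => ?_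
  rw [append_mem_accepts_iff, append_mem_accepts_iff, hq, hq, hij]

end NFA

/-! ### Crossing behaviour of two-way automata -/

namespace TwoNFA

variable {α σ : Type*} (M : TwoNFA α σ)

/-- Moves on the left end-marker and on the letters of a prefix `u`. -/
def PrefixMove (u : List α) (c d : σ × ℕ) : Prop :=
  M.Move u c d ∧ c.2 ≤ u.length

/-- Moves on the letters of a suffix `v` and on the right end-marker; the letters of `v` are in the
cells `1, …, |v|`. -/
def SuffixMove (v : List α) (c d : σ × ℕ) : Prop :=
  M.Move v c d ∧ 0 < c.2

/-- The states in which the head can leave the prefix `u` for the first time. -/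
def prefixExit (u : List α) : Set σ :=
  {q | Relation.ReflTransGen (M.PrefixMove u) (M.start, 1) (q, u.length + 1)}

/-- The pairs of states in which the head can enter the prefix `u` from the right and leave it. -/
def prefixReturn (u : List α) : Set (σ × σ) :=
  {r | Relation.ReflTransGen (M.PrefixMove u) (r.1, u.length) (r.2, u.length + 1)}

/-- The pairs of states in which the head can enter the suffix `v` from the left and leave it
to the left. -/
def suffixReturn (v : List α) : Set (σ × σ) :=
  {r | Relation.ReflTransGen (M.SuffixMove v) (r.1, 1) (r.2, 0)}

/-- The states in which the head can enter the suffix `v` and then accept inside it. -/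
def suffixAccept (v : List α) : Set σ :=
  {p | ∃ q ∈ M.accept, Relation.ReflTransGen (M.SuffixMove v) (p, 1) (q, v.length + 2)}

theorem move_iff {w : List α} {p q : σ} {i j : ℕ} :
    M.Move w (p, i) (q, j) ↔ ∃ s, (tape w)[i]? = some s ∧
      ((q, Turing.Dir.right) ∈ M.step p s ∧ j = i + 1 ∨
        (q, Turing.Dir.left) ∈ M.step p s ∧ i = j + 1) := by
  constructor
  · rintro (⟨h, hs⟩ | ⟨h, hs⟩)
    · exact ⟨_, h, .inl ⟨hs, rfl⟩⟩
    · exact ⟨_, h, .inr ⟨hs, rfl⟩⟩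
  · rintro ⟨s, h, ⟨hs, rfl⟩ | ⟨hs, rfl⟩⟩
    · exact .right h hs
    · exact .left h hs

theorem tape_append_getElem?_of_le {u : List α} (v : List α) {i : ℕ} (hi : i ≤ u.length) :
    (tape (u ++ v))[i]? = (tape u)[i]? := by
  cases i with
  | zero => rfl
  | succ i =>
    have hi' : i < (u.map TapeSymbol.letter).length := by simpa using hi
    simp only [tape, List.getElem?_cons_succ, List.map_append, List.append_assoc]
    rw [List.getElem?_append_left hi', List.getElem?_append_left hi']

theorem tape_append_getElem?_add (u v : List α) {i : ℕ} (hi : 0 < i) :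
    (tape (u ++ v))[i + u.length]? = (tape v)[i]? := by
  obtain ⟨i, rfl⟩ := Nat.exists_eq_add_of_lt hi
  have h : 0 + i + 1 + u.length = (i + (u.map (TapeSymbol.letter (α := α))).length) + 1 := by
    simp; omega
  rw [h]
  simp only [tape, List.getElem?_cons_succ, List.map_append, List.append_assoc, zero_add]
  rw [List.getElem?_append_right (by omega), Nat.add_sub_cancel]

theorem prefixMove_iff (u v : List α) {c d : σ × ℕ} :
    M.PrefixMove u c d ↔ M.Move (u ++ v) c d ∧ c.2 ≤ u.length := by
  obtain ⟨p, i⟩ := c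
  obtain ⟨q, j⟩ := d
  refine and_congr_left fun hi => ?_
  rw [move_iff, move_iff, tape_append_getElem?_of_le v hi]

/-- Shifting by `|u|` matches the two tapes except in cell `0`, which holds the end-marker on the
tape of `v` but the last cell of the `u` side on the joint tape; hence `0 < i`. -/
theorem suffixMove_iff (u v : List α) {p q : σ} {i j : ℕ} :
    M.SuffixMove v (p, i) (q, j) ↔
      M.Move (u ++ v) (p, i + u.length) (q, j + u.length) ∧ 0 < i := by
  refine and_congr_left fun hi => ?_
  rw [move_iff, move_iff, tape_append_getElem?_add u v hi]
  have h₁ : j + u.length = i + u.length + 1 ↔ j = i + 1 := by omega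
  have h₂ : i + u.length = j + u.length + 1 ↔ i = j + 1 := by omega
  rw [h₁, h₂]

theorem Move.snd_le {M : TwoNFA α σ} {w : List α} {c d : σ × ℕ} (h : M.Move w c d) :
    d.2 ≤ c.2 + 1 ∧ c.2 ≤ d.2 + 1 := by
  cases h <;> simp <;> omega

theorem reflTransGen_of_prefix {u : List α} (v : List α) {c d : σ × ℕ}
    (h : Relation.ReflTransGen (M.PrefixMove u) c d) :
    Relation.ReflTransGen (M.Move (u ++ v)) c d :=
  Relation.ReflTransGen.mono (fun _ _ h => ((M.prefixMove_iff u v).1 h).1) _ _ h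

theorem reflTransGen_of_suffix (u : List α) {v : List α} {p q : σ} {i j : ℕ}
    (h : Relation.ReflTransGen (M.SuffixMove v) (p, i) (q, j)) :
    Relation.ReflTransGen (M.Move (u ++ v)) (p, i + u.length) (q, j + u.length) :=
  Relation.ReflTransGen.lift (fun c : σ × ℕ => (c.1, c.2 + u.length))
    (fun _ _ h => ((M.suffixMove_iff u v).1 h).1) _ _ h

/-- The states in which the head can enter the suffix and eventually accept, in terms of the
behaviour of the prefix and of the suffix. -/
def Accepting (B C : Set (σ × σ)) (D : Set σ) (p : σ) : Prop :=
  ∃ q ∈ D, Relation.ReflTransGen (fun p q => ∃ r, (p, r) ∈ C ∧ (r, q) ∈ B) p q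

theorem Accepting.head {B C : Set (σ × σ)} {D : Set σ} {p r q : σ} (hC : (p, r) ∈ C)
    (hB : (r, q) ∈ B) (h : Accepting B C D q) : Accepting B C D p := by
  obtain ⟨f, hf, h⟩ := h
  exact ⟨f, hf, h.head ⟨r, hC, hB⟩⟩

/-- Cuts an accepting computation at its crossings of the boundary, by induction from its end. The
claim covers every configuration, on either side, so that the induction passes through the interior
of a segment. -/
theorem accepting_of_reflTransGen {u v : List α} {f : σ} (hf : f ∈ M.accept) {c : σ × ℕ}
    (h : Relation.ReflTransGen (M.Move (u ++ v)) c (f, (u ++ v).length + 2)) :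
    (c.2 ≤ u.length → ∃ q, Relation.ReflTransGen (M.PrefixMove u) c (q, u.length + 1) ∧
      Accepting (M.prefixReturn u) (M.suffixReturn v) (M.suffixAccept v) q) ∧
    ∀ p i, c = (p, i + 1 + u.length) →
      (∃ r q, Relation.ReflTransGen (M.SuffixMove v) (p, i + 1) (r, 0) ∧
        (r, q) ∈ M.prefixReturn u ∧
        Accepting (M.prefixReturn u) (M.suffixReturn v) (M.suffixAccept v) q) ∨
      ∃ f ∈ M.accept, Relation.ReflTransGen (M.SuffixMove v) (p, i + 1) (f, v.length + 2) := by
  induction h using Relation.ReflTransGen.head_induction_on with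
  | refl =>
    refine ⟨fun h => ?_, fun p i h => .inr ⟨f, hf, ?_⟩⟩
    · simp at h; omega
    · simp only [Prod.mk.injEq, List.length_append] at h
      obtain ⟨rfl, h⟩ := h
      rw [show i + 1 = v.length + 2 by omega]
  | @head c d hm _ ih =>
    obtain ⟨ih₁, ih₂⟩ := ih
    obtain ⟨q, j⟩ := d
    have hle := hm.snd_le
    constructor
    · intro hc
      have hm' : M.PrefixMove u c (q, j) := (M.prefixMove_iff u v).2 ⟨hm, hc⟩
      by_cases hj : j ≤ u.length
      · obtain ⟨r, hr, ha⟩ := ih₁ hj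
        exact ⟨r, hr.head hm', ha⟩
      · obtain rfl : j = u.length + 1 := by simp at hle; omega
        refine ⟨q, .single hm', ?_⟩
        obtain ⟨r, t, h₁, h₂, h₃⟩ | h := ih₂ q 0 (by simp [add_comm])
        · exact h₃.head h₁ h₂
        · exact ⟨q, h, .refl⟩
    · rintro p i rfl
      by_cases hj : j ≤ u.length
      · obtain rfl : j = u.length := by simp at hle; omega
        obtain ⟨t, ht, ha⟩ := ih₁ hj
        refine .inl ⟨q, t, .single ?_, ht, ha⟩
        exact (M.suffixMove_iff u v).2 ⟨by simpa using hm, by omega⟩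
      · obtain ⟨k, rfl⟩ : ∃ k, j = k + 1 + u.length := ⟨j - u.length - 1, by omega⟩
        have hm' : M.SuffixMove v (p, i + 1) (q, k + 1) :=
          (M.suffixMove_iff u v).2 ⟨hm, by omega⟩
        obtain ⟨r, t, h₁, h₂⟩ | ⟨f, hf, h⟩ := ih₂ q k rfl
        · exact .inl ⟨r, t, h₁.head hm', h₂⟩
        · exact .inr ⟨f, hf, h.head hm'⟩

/-- Conversely, segments on the two sides are glued at the boundary cells `|u|` and `|u| + 1`. -/
theorem reflTransGen_of_accepting {u v : List α} {p : σ}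
    (h : Accepting (M.prefixReturn u) (M.suffixReturn v) (M.suffixAccept v) p) :
    ∃ f ∈ M.accept,
      Relation.ReflTransGen (M.Move (u ++ v)) (p, u.length + 1) (f, (u ++ v).length + 2) := by
  obtain ⟨q, ⟨f, hf, hq⟩, h⟩ := h
  refine ⟨f, hf, ?_⟩
  induction h using Relation.ReflTransGen.head_induction_on with
  | refl =>
    have := M.reflTransGen_of_suffix u hq
    rwa [add_comm 1, show v.length + 2 + u.length = (u ++ v).length + 2 by simp; omega] at this
  | head hr _ ih =>
    obtain ⟨r, hC, hB⟩ := hr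
    have h₁ := M.reflTransGen_of_suffix u hC
    rw [add_comm 1, zero_add] at h₁
    exact h₁.trans ((M.reflTransGen_of_prefix v hB).trans ih)

/-- Acceptance of `u ++ v` depends only on the crossing behaviours of `u` and of `v`. -/
theorem append_mem_accepts_iff {u v : List α} :
    u ++ v ∈ M.accepts ↔ ∃ p ∈ M.prefixExit u,
      Accepting (M.prefixReturn u) (M.suffixReturn v) (M.suffixAccept v) p := by
  constructor
  · rintro ⟨f, hf, h⟩
    -- If `u` is empty, the initial cell `1` already belongs to the suffix.
    obtain hu | hu := Nat.eq_zero_or_pos u.length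
    · refine ⟨M.start, ?_, ?_⟩
      · rw [prefixExit, hu]
        exact .refl
      · obtain ⟨r, t, h₁, h₂, h₃⟩ | h := (M.accepting_of_reflTransGen hf h).2 M.start 0 (by simp [hu])
        · exact h₃.head h₁ h₂
        · exact ⟨M.start, h, .refl⟩
    · exact (M.accepting_of_reflTransGen hf h).1 hu
  · rintro ⟨p, hp, h⟩
    obtain ⟨f, hf, h⟩ := M.reflTransGen_of_accepting h
    exact ⟨f, hf, (M.reflTransGen_of_prefix v hp).trans h⟩

theorem card_le_of_injective_crossing {ι : Type*} [Fintype ι] [Fintype σ]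
    (g : ι → Set σ × Set (σ × σ)) (hg : Function.Injective g) :
    Fintype.card ι ≤ 2 ^ (Fintype.card σ + Fintype.card σ ^ 2) := by
  classical
  refine (Fintype.card_le_of_injective g hg).trans_eq ?_
  rw [Fintype.card_prod, Fintype.card_set, Fintype.card_set, Fintype.card_prod, ← pow_add, sq]

/-- Shepherdson's bound: inequivalent prefixes have different crossing behaviours. -/
theorem card_le_of_prefixes {ι : Type*} [Fintype ι] [Fintype σ] (u : ι → List α)
    (h : ∀ i j, (∀ v, u i ++ v ∈ M.accepts ↔ u j ++ v ∈ M.accepts) → i = j) :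
    Fintype.card ι ≤ 2 ^ (Fintype.card σ + Fintype.card σ ^ 2) := by
  refine card_le_of_injective_crossing (fun i => (M.prefixExit (u i), M.prefixReturn (u i)))
    fun i j hij => h i j fun v => ?_
  obtain ⟨h₁, h₂⟩ := Prod.mk.injEq .. ▸ hij
  rw [append_mem_accepts_iff, append_mem_accepts_iff, h₁, h₂]

/-- The analogue of Shepherdson's bound for suffixes. -/
theorem card_le_of_suffixes {ι : Type*} [Fintype ι] [Fintype σ] (v : ι → List α)
    (h : ∀ i j, (∀ u, u ++ v i ∈ M.accepts ↔ u ++ v j ∈ M.accepts) → i = j) :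
    Fintype.card ι ≤ 2 ^ (Fintype.card σ + Fintype.card σ ^ 2) := by
  refine card_le_of_injective_crossing (fun i => (M.suffixAccept (v i), M.suffixReturn (v i)))
    fun i j hij => h i j fun u => ?_
  obtain ⟨h₁, h₂⟩ := Prod.mk.injEq .. ▸ hij
  rw [append_mem_accepts_iff, append_mem_accepts_iff, h₁, h₂]

end TwoNFA

/-! ### Counting and the lower bounds -/

theorem two_rpow_le_of_two_pow_two_pow_le {n N : ℕ} (h : 2 ^ 2 ^ n ≤ 2 ^ (N + N ^ 2)) :
    (2 : ℝ) ^ (((n : ℝ) - 1) / 2) ≤ (N : ℝ) := by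
  have h₁ : 2 ^ n ≤ N + N ^ 2 := (Nat.pow_le_pow_iff_right one_lt_two).1 h
  have h₂ : 2 ^ n ≤ 2 * N ^ 2 := by nlinarith [Nat.le_self_pow two_ne_zero N]
  have h₃ : (2 : ℝ) ^ n ≤ 2 * (N : ℝ) ^ 2 := by exact_mod_cast h₂
  refine (pow_le_pow_iff_left₀ (by positivity) (Nat.cast_nonneg N) two_ne_zero).1 ?_
  rw [← Real.rpow_natCast, ← Real.rpow_mul zero_le_two]
  push_cast
  rw [div_mul_cancel₀ _ two_ne_zero, Real.rpow_sub_one two_ne_zero, Real.rpow_natCast]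
  linarith

theorem card_finset_blocks (n : ℕ) : Fintype.card (Finset (Fin n → Bool)) = 2 ^ 2 ^ n := by
  simp

theorem blockList_prefix_inequivalent {n : ℕ} (hn : 0 < n) (S T : Finset (Fin n → Bool))
    (h : ∀ v, (blockList S).flatten ++ v ∈ langK n ↔ (blockList T).flatten ++ v ∈ langK n) :
    S = T := by
  ext x
  rw [← blockList_append_ofFn_mem_langK_iff hn, h, blockList_append_ofFn_mem_langK_iff hn]

theorem blockList_suffix_inequivalent {n : ℕ} (hn : 0 < n) (S T : Finset (Fin n → Bool))
    (h : ∀ u, u ++ (blockList S).flatten ∈ langJ n ↔ u ++ (blockList T).flatten ∈ langJ n) :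
    S = T := by
  ext x
  rw [← ofFn_append_blockList_mem_langJ_iff hn, h, ofFn_append_blockList_mem_langJ_iff hn]

/-- Lets the 1DFA bound cover partial transition functions: a prefix of an accepted word cannot get
stuck. -/
theorem exists_blockList_append_mem_langK {n : ℕ} (S : Finset (Fin n → Bool)) :
    ∃ v, (blockList S).flatten ++ v ∈ langK n := by
  let x : List Bool := List.ofFn fun _ : Fin n => false
  -- The first copy of `x` is the block that the final copy repeats, so `S` may be empty.
  refine ⟨x ++ x, blockList S ++ [x], x, by simp, ?_, by simp [x], by simp, by simp⟩
  intro y hy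
  obtain hy | hy := List.mem_append.1 hy
  · exact length_of_mem_blockList hy
  · rw [List.mem_singleton.1 hy, List.length_ofFn]

theorem two_pow_le_card_of_accepts_langJ {n : ℕ} (hn : 0 < n) {σ : Type*} [Fintype σ]
    (M : NFA Bool σ) (hM : M.accepts = langJ n) : 2 ^ n ≤ Fintype.card σ := by
  simpa using M.card_le_of_fooling_set (ι := Fin n → Bool) List.ofFn List.ofFn
    fun x y => by rw [hM, ofFn_append_ofFn_mem_langJ_iff hn]

theorem theorem2 (n : ℕ) (hn : 0 < n) :
    -- lower bounds for `J_n`: one-way deterministic, one-way and two-way nondeterministic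
    ((∀ (σ : Type*) [Fintype σ] (M : NFA Bool σ), M.IsDeterministic → M.accepts = langJ n →
        2 ^ n ≤ Fintype.card σ) ∧
      (∀ (σ : Type*) [Fintype σ] (M : NFA Bool σ), M.accepts = langJ n →
        2 ^ n ≤ Fintype.card σ) ∧
      (∀ (σ : Type*) [Fintype σ] (M : TwoNFA Bool σ), M.accepts = langJ n →
        (2 : ℝ) ^ (((n : ℝ) - 1) / 2) ≤ (Fintype.card σ : ℝ))) ∧
    -- lower bounds for `K_n`: one-way deterministic, one-way and two-way nondeterministic
    ((∀ (σ : Type*) [Fintype σ] (M : NFA Bool σ), M.IsDeterministic → M.accepts = langK n →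
        2 ^ 2 ^ n ≤ Fintype.card σ) ∧
      (∀ (σ : Type*) [Fintype σ] (M : NFA Bool σ), M.accepts = langK n →
        2 ^ n ≤ Fintype.card σ) ∧
      (∀ (σ : Type*) [Fintype σ] (M : TwoNFA Bool σ), M.accepts = langK n →
        (2 : ℝ) ^ (((n : ℝ) - 1) / 2) ≤ (Fintype.card σ : ℝ))) := by
  refine ⟨⟨fun σ _ M _ hM => ?_, fun σ _ M hM => ?_, fun σ _ M hM => ?_⟩,
    fun σ _ M hD hM => ?_, fun σ _ M hM => ?_, fun σ _ M hM => ?_⟩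
  · exact two_pow_le_card_of_accepts_langJ hn M hM
  · exact two_pow_le_card_of_accepts_langJ hn M hM
  · refine two_rpow_le_of_two_pow_two_pow_le ?_
    rw [← card_finset_blocks]
    refine M.card_le_of_suffixes (fun S => (blockList S).flatten) ?_
    rw [hM]
    exact blockList_suffix_inequivalent hn
  · rw [← card_finset_blocks]
    refine hD.card_le (fun S => (blockList S).flatten) ?_ ?_
    · rw [hM]
      exact exists_blockList_append_mem_langK
    · rw [hM]
      exact blockList_prefix_inequivalent hn
  · simpa using M.card_le_of_fooling_set (ι := Fin n → Bool) List.ofFn List.ofFn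
      fun x y => by rw [hM, ofFn_append_ofFn_mem_langK_iff hn]
  · refine two_rpow_le_of_two_pow_two_pow_le ?_
    rw [← card_finset_blocks]
    refine M.card_le_of_prefixes (fun S => (blockList S).flatten) ?_
    rw [hM]
    exact blockList_prefix_inequivalent hn
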